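/- Let $\lambda$ be a Young diagram with $n$ boxes and let $\rho^\lambda$ be the corresponding irreducible representation of $S_n$ over $\mathbb{C}$; write $\chi^\lambda(g)=\operatorname{Tr}\rho^\lambda(g)/\operatorname{Tr}\rho^\lambda(e)$. *Disjoint cumulants.* A partial permutation of $\{1,\dots,n\}$ is a pair $\alpha=(A,w)$ with $A\subseteq\{1,\dots,n\}$ and $w$ a permutation of $A$ (extended by the identity to an element of $S_n$). On the vector space spanned by partial permutations define the disjoint product $\bullet$ bilinearly by $(A,w)\bullet(B,v)=(A\cup B,wv)$ if $A\cap B=\emptyset$ and $(A,w)\bullet(B,v)=0$ otherwise; this is a commutative unital algebra. Let $\mathbb{E}$ be the linear functional on it with $\mathbb{E}(A,w)=\chi^\lambda(w)$. For $\pi\in S_l$ the normalized conjugacy class is $$\Sigma_\pi=\sum_{f}\bigl(f(\{1,\dots,l\}),\ f\circ\pi\circ f^{-1}\bigr),$$ the sum over all injective functions $f:\{1,\dots,l\}\to\{1,\dots,n\}$. The disjoint cumulants $k^\bullet$ with respect to $\rho^\lambda$ are the cumulants for the product $\bullet$ and the functional $\mathbb{E}$, i.e. they are determined by $$\mathbb{E}(X_1\bullet\cdots\bullet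 X_m)=\sum_{P}\ \prod_{B\in P}k^\bullet\bigl(X_i: i\in B\bigr)\qquad(m\ge 1),$$ where $P$ runs over all set partitions of $\{1,\dots,m\}$. *Colorings.* For a permutation $\sigma$ let $|\sigma|$ be the minimal number of factors needed to write $\sigma$ as a product of transpositions, and let $C(\sigma)$ be the set of its cycles (fixed points included). Let $N^\lambda(\sigma_1,\sigma_2)$ be the number of functions $h:C(\sigma_1)\sqcup C(\sigma_2)\to\{1,2,\dots\}$ such that $h(c_1)\le\lambda_{h(c_2)}$ for all $c_1\in C(\sigma_1)$, $c_2\in C(\sigma_2)$ with $c_1\cap c_2\ne\emptyset$ (where $\lambda_j$ is the length of the $j$-th row, and $\lambda_j=0$ if there is no such row). **Proposition.** Let $r\ge 1$, $l_1,\dots,l_r\ge 1$ and $\pi_1\in S_{l_1},\dots,\pi_r\in S_{l_r}$. Then $$k^{\bullet}(\Sigma_{\pi_1},\dots,\Sigma_{\pi_r})=\sum_{\substack{\sigma_1,\sigma_2\in S_{l_1+\cdots+l_r},\ \sigma_1\sigma_2=\pi_1\times\cdots\times\pi_r,\\ \langle\sigma_1,\sigma_2,\,S_{l_1}\times\cdots\times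 S_{l_r}\rangle\text{ is transitive}}}(-1)^{|\sigma_1|}\,N^\lambda(\sigma_1,\sigma_2).$$ Here $\{1,\dots,l_1+\cdots+l_r\}$ is identified with the disjoint union of the sets $\{1,\dots,l_i\}$, and the sum runs over all factorizations for which $\sigma_1$, $\sigma_2$ and $S_{l_1}\times\cdots\times S_{l_r}$ together generate a group that acts transitively on this set. -/

import Mathlib

/-! ### The irreducible representation attached to a Young diagram -/

/-- `σ` moves the entries of the tableau `T` within the rows.
In Mathlib's `YoungDiagram` the first coordinate of a box is its row, the second its column
(both numbered from `0`). -/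
def PreservesRows {n : ℕ} {lam : YoungDiagram} (T : Fin n ≃ lam.cells)
    (σ : Equiv.Perm (Fin n)) : Prop :=
  ∀ x, (T (σ x)).1.1 = (T x).1.1

/-- `σ` moves the entries of the tableau `T` within the columns. -/
def PreservesCols {n : ℕ} {lam : YoungDiagram} (T : Fin n ≃ lam.cells)
    (σ : Equiv.Perm (Fin n)) : Prop :=
  ∀ x, (T (σ x)).1.2 = (T x).1.2

open Classical in
/-- The row symmetrizer `a = ∑_{σ preserves the rows} σ`. -/
noncomputable def rowSymmetrizer {n : ℕ} {lam : YoungDiagram} (T : Fin n ≃ lam.cells) :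
    MonoidAlgebra ℂ (Equiv.Perm (Fin n)) :=
  ∑ σ with PreservesRows T σ, MonoidAlgebra.single σ 1

open Classical in
/-- The column antisymmetrizer `b = ∑_{σ preserves the columns} sgn(σ) σ`. -/
noncomputable def colAntisymmetrizer {n : ℕ} {lam : YoungDiagram} (T : Fin n ≃ lam.cells) :
    MonoidAlgebra ℂ (Equiv.Perm (Fin n)) :=
  ∑ σ with PreservesCols T σ, MonoidAlgebra.single σ ((Equiv.Perm.sign σ : ℤ) : ℂ)

/-- The Young symmetrizer `c = b a`. -/
noncomputable def youngSymmetrizer {n : ℕ} {lam : YoungDiagram} (T : Fin n ≃ lam.cells) :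
    MonoidAlgebra ℂ (Equiv.Perm (Fin n)) :=
  colAntisymmetrizer T * rowSymmetrizer T

/-- The space `V^λ = ℂ[S_n] c`. -/
noncomputable def youngModule {n : ℕ} {lam : YoungDiagram} (T : Fin n ≃ lam.cells) :
    Submodule ℂ (MonoidAlgebra ℂ (Equiv.Perm (Fin n))) :=
  LinearMap.range (LinearMap.mulRight ℂ (youngSymmetrizer T))

theorem mul_mem_youngModule {n : ℕ} {lam : YoungDiagram} (T : Fin n ≃ lam.cells)
    (y : MonoidAlgebra ℂ (Equiv.Perm (Fin n))) :
    ∀ x ∈ youngModule T, LinearMap.mulLeft ℂ y x ∈ youngModule T := by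
  rintro x ⟨z, rfl⟩
  exact ⟨y * z, by simp [mul_assoc]⟩

/-- The irreducible representation `ρ^λ` of `S_n`: the group acts on `ℂ[S_n] c` by left
multiplication. (Up to isomorphism it does not depend on the tableau `T`, that is, on the
numbering of the boxes.) -/
noncomputable def youngRep {n : ℕ} {lam : YoungDiagram} (T : Fin n ≃ lam.cells) :
    Representation ℂ (Equiv.Perm (Fin n)) (youngModule T) where
  toFun g := (LinearMap.mulLeft ℂ (MonoidAlgebra.single g 1)).restrict (mul_mem_youngModule T _)
  map_one' := by
    ext x
    simp [← MonoidAlgebra.one_def]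
  map_mul' g h := by
    ext1 x
    apply Subtype.ext
    simp [← mul_assoc, MonoidAlgebra.single_mul_single]

/-- The rescaled character `χ(g) = Tr ρ(g) / Tr ρ(e)`. -/
noncomputable def normalizedCharacter {G V : Type*} [Monoid G] [AddCommGroup V] [Module ℂ V]
    (ρ : Representation ℂ G V) (g : G) : ℂ :=
  LinearMap.trace ℂ V (ρ g) / LinearMap.trace ℂ V (ρ 1)

/-! ### Partial permutations and the disjoint product -/

/-- A partial permutation of `α`: a finite set (the support) and a permutation of that set,
recorded as a permutation of `α` which fixes every point outside of the support. The support may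
be bigger than the set of points that are moved. -/
@[ext]
structure PartialPermutation (α : Type*) where
  supp : Finset α
  perm : Equiv.Perm α
  fix : ∀ x, x ∉ supp → perm x = x

namespace PartialPermutation

variable {α : Type*} [DecidableEq α]

/-- The empty partial permutation. -/
def empty (α : Type*) : PartialPermutation α := ⟨∅, 1, fun _ _ => rfl⟩

/-- The product of partial permutations: union of supports, composition of permutations. -/
def comp (a b : PartialPermutation α) : PartialPermutation α where
  supp := a.supp ∪ b.supp
  perm := a.perm * b.perm
  fix x hx := by
    simp only [Finset.mem_union, not_or] at hx
    simp [b.fix x hx.2, a.fix x hx.1]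

theorem comp_comm {a b : PartialPermutation α} (h : Disjoint a.supp b.supp) :
    a.comp b = b.comp a := by
  ext1
  · exact Finset.union_comm _ _
  · refine Equiv.Perm.Disjoint.commute fun x => ?_
    by_cases hx : x ∈ a.supp
    · exact Or.inr (b.fix x (Finset.disjoint_left.1 h hx))
    · exact Or.inl (a.fix x hx)

theorem comp_assoc (a b c : PartialPermutation α) : (a.comp b).comp c = a.comp (b.comp c) := by
  ext1
  · exact Finset.union_assoc _ _ _
  · exact mul_assoc _ _ _

theorem empty_comp (a : PartialPermutation α) : (empty α).comp a = a := by
  ext1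
  · exact Finset.empty_union _
  · exact one_mul _

end PartialPermutation

/-- The vector space of formal linear combinations of partial permutations, to be equipped with the
disjoint product. -/
def DisjointAlgebra (α : Type*) : Type _ := PartialPermutation α →₀ ℂ

namespace DisjointAlgebra

noncomputable instance (α : Type*) : AddCommGroup (DisjointAlgebra α) :=
  inferInstanceAs (AddCommGroup (PartialPermutation α →₀ ℂ))

noncomputable instance (α : Type*) : Module ℂ (DisjointAlgebra α) :=
  inferInstanceAs (Module ℂ (PartialPermutation α →₀ ℂ))

/-- The basis vector given by a partial permutation. -/
noncomputable def of {α : Type*} (a : PartialPermutation α) : DisjointAlgebra α :=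
  Finsupp.single a 1

/-- Linear extension of a function on partial permutations. -/
noncomputable def lift {α M : Type*} [AddCommGroup M] [Module ℂ M]
    (f : PartialPermutation α → M) : DisjointAlgebra α →ₗ[ℂ] M :=
  Finsupp.linearCombination ℂ f

theorem lift_of {α M : Type*} [AddCommGroup M] [Module ℂ M]
    (f : PartialPermutation α → M) (a : PartialPermutation α) : lift f (of a) = f a := by
  exact (Finsupp.linearCombination_single ℂ 1 a).trans (one_smul ℂ (f a))

theorem hom_ext {α M : Type*} [AddCommGroup M] [Module ℂ M]
    {f g : DisjointAlgebra α →ₗ[ℂ] M} (h : ∀ a, f (of a) = g (of a)) : f = g := by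
  apply Finsupp.lhom_ext'
  intro a
  apply LinearMap.ext_ring
  exact h a

variable {α : Type*} [DecidableEq α]

/-- The disjoint product of two partial permutations: their product if the supports are disjoint,
and zero otherwise. -/
noncomputable def basisMul (a b : PartialPermutation α) : DisjointAlgebra α :=
  if Disjoint a.supp b.supp then of (a.comp b) else 0

/-- The disjoint product, extended bilinearly. -/
noncomputable def mulMap : DisjointAlgebra α →ₗ[ℂ] DisjointAlgebra α →ₗ[ℂ] DisjointAlgebra α :=
  lift fun a => lift fun b => basisMul a b

theorem mulMap_of_of (a b : PartialPermutation α) : mulMap (of a) (of b) = basisMul a b := by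
  simp [mulMap, lift_of]

theorem mulMap_comm (x y : DisjointAlgebra α) : mulMap x y = mulMap y x := by
  suffices h : (mulMap : DisjointAlgebra α →ₗ[ℂ] _) = mulMap.flip from
    congrArg (fun f : DisjointAlgebra α →ₗ[ℂ] DisjointAlgebra α →ₗ[ℂ] DisjointAlgebra α =>
      f x y) h
  refine hom_ext fun a => hom_ext fun b => ?_
  rw [LinearMap.flip_apply, mulMap_of_of, mulMap_of_of, basisMul, basisMul]
  by_cases h : Disjoint a.supp b.supp
  · rw [if_pos h, if_pos h.symm, PartialPermutation.comp_comm h]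
  · rw [if_neg h, if_neg fun h' => h h'.symm]

theorem mulMap_assoc (x y z : DisjointAlgebra α) :
    mulMap (mulMap x y) z = mulMap x (mulMap y z) := by
  have h₁ : ∀ a b c : PartialPermutation α,
      mulMap (mulMap (of a) (of b)) (of c) = mulMap (of a) (mulMap (of b) (of c)) := by
    intro a b c
    simp only [mulMap_of_of, basisMul]
    by_cases hab : Disjoint a.supp b.supp <;> by_cases hbc : Disjoint b.supp c.supp <;>
      by_cases hac : Disjoint a.supp c.supp <;>
      simp [hab, hbc, hac, mulMap_of_of, basisMul, PartialPermutation.comp,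
        Finset.disjoint_union_left, Finset.disjoint_union_right, Finset.union_assoc, mul_assoc]
  have h₂ : ∀ (a b : PartialPermutation α) (z : DisjointAlgebra α),
      mulMap (mulMap (of a) (of b)) z = mulMap (of a) (mulMap (of b) z) := fun a b z =>
    LinearMap.congr_fun (hom_ext (f := mulMap (mulMap (of a) (of b)))
      (g := mulMap (of a) ∘ₗ mulMap (of b)) fun c => h₁ a b c) z
  have h₃ : ∀ (a : PartialPermutation α) (y z : DisjointAlgebra α),
      mulMap (mulMap (of a) y) z = mulMap (of a) (mulMap y z) := fun a y z =>
    LinearMap.congr_fun (hom_ext (f := mulMap.flip z ∘ₗ mulMap (of a))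
      (g := mulMap (of a) ∘ₗ mulMap.flip z) fun b => h₂ a b z) y
  exact LinearMap.congr_fun (hom_ext (f := mulMap.flip z ∘ₗ mulMap.flip y)
    (g := mulMap.flip (mulMap y z)) fun a => h₃ a y z) x

theorem one_mulMap (x : DisjointAlgebra α) : mulMap (of (PartialPermutation.empty α)) x = x := by
  suffices h : mulMap (of (PartialPermutation.empty α)) = LinearMap.id from
    congrArg (fun f : DisjointAlgebra α →ₗ[ℂ] DisjointAlgebra α => f x) h
  refine hom_ext fun a => ?_
  rw [mulMap_of_of, basisMul, if_pos (by simp [PartialPermutation.empty]),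
    PartialPermutation.empty_comp, LinearMap.id_apply]

/-- The commutative algebra of partial permutations with the disjoint product. -/
noncomputable instance : CommRing (DisjointAlgebra α) where
  __ := (inferInstance : AddCommGroup (DisjointAlgebra α))
  mul x y := mulMap x y
  one := of (PartialPermutation.empty α)
  mul_assoc := mulMap_assoc
  mul_comm := mulMap_comm
  one_mul := one_mulMap
  mul_one x := (mulMap_comm _ _).trans (one_mulMap x)
  left_distrib x := map_add (mulMap x)
  right_distrib x y z := congrArg (fun f : DisjointAlgebra α →ₗ[ℂ] DisjointAlgebra α => f z)
    (map_add mulMap x y)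
  zero_mul z := congrArg (fun f : DisjointAlgebra α →ₗ[ℂ] DisjointAlgebra α => f z)
    (map_zero mulMap)
  mul_zero x := map_zero (mulMap x)

theorem of_mul_of (a b : PartialPermutation α) :
    of a * of b = if Disjoint a.supp b.supp then of (a.comp b) else 0 :=
  mulMap_of_of a b

end DisjointAlgebra

/-- The partial permutation obtained by placing `π ∈ S_l` on the image of an injective function
`f : {1, …, l} → α`. -/
def PartialPermutation.place {l : ℕ} {α : Type*} [DecidableEq α] (π : Equiv.Perm (Fin l))
    (f : Fin l ↪ α) : PartialPermutation α where
  supp := Finset.univ.map f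
  perm := π.viaFintypeEmbedding f
  fix x hx := Equiv.Perm.viaFintypeEmbedding_apply_notMem_range π f (by simpa using hx)

/-- The normalized conjugacy class `Σ_π`, `π ∈ S_l`, in the algebra of partial permutations of
`{1, …, n}`: the sum over all injective functions `f : {1, …, l} → {1, …, n}` of the permutation
`f ∘ π ∘ f⁻¹` of the set `f({1, …, l})`. -/
noncomputable def conjClassSum {l : ℕ} (n : ℕ) (π : Equiv.Perm (Fin l)) :
    DisjointAlgebra (Fin n) :=
  ∑ f : Fin l ↪ Fin n, DisjointAlgebra.of (PartialPermutation.place π f)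

/-- The expectation given by a representation `ρ` of `S_n`: forget the supports and take the
rescaled character. -/
noncomputable def charExpectation {n : ℕ} {V : Type*} [AddCommGroup V] [Module ℂ V]
    (ρ : Representation ℂ (Equiv.Perm (Fin n)) V) : DisjointAlgebra (Fin n) →ₗ[ℂ] ℂ :=
  DisjointAlgebra.lift fun a => normalizedCharacter ρ a.perm

/-! ### Cumulants -/

/-- The cumulants, with respect to a functional `E` on a commutative algebra, of the subfamilies
`(X i)_{i ∈ s}` of a family `X`. They are determined by the moment-cumulant formula
`E (∏_{i ∈ s} X i) = ∑_P ∏_{B ∈ P} k_B`, the sum running over all set partitions `P` of `s`; the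
recursion solves it for the term of the one-block partition `{s}`. -/
noncomputable def jointCumulant {A ι : Type*} [CommRing A] [Module ℂ A] [DecidableEq ι]
    (E : A →ₗ[ℂ] ℂ) (X : ι → A) (s : Finset ι) : ℂ :=
  E (∏ i ∈ s, X i) -
    ∑ P : {P : Finpartition s // s ∉ P.parts}, ∏ B ∈ P.1.parts.attach, jointCumulant E X B.1
termination_by s.card
decreasing_by
  refine Finset.card_lt_card (lt_of_le_of_ne (P.1.le B.2) fun h => P.2 ?_)
  have hB := B.2
  rwa [h] at hB

/-- The moment-cumulant formula. -/
theorem moment_eq_sum_jointCumulant {A ι : Type*} [CommRing A] [Module ℂ A] [DecidableEq ι]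
    (E : A →ₗ[ℂ] ℂ) (X : ι → A) (s : Finset ι) (hs : s.Nonempty) :
    E (∏ i ∈ s, X i) = ∑ P : Finpartition s, ∏ B ∈ P.parts, jointCumulant E X B := by
  classical
  have key : ∀ P : Finpartition s, s ∈ P.parts → P.parts = {s} := by
    intro P hP
    refine Finset.eq_singleton_iff_unique_mem.2 ⟨hP, fun B hB => ?_⟩
    by_contra hne
    have hd := P.disjoint hB hP hne
    obtain ⟨x, hx⟩ := P.nonempty_of_mem_parts hB
    exact Finset.disjoint_left.1 hd hx (P.le hB hx)
  let P₀ : Finpartition s := Finpartition.indiscrete hs.ne_empty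
  have h1 : ∑ P : {P : Finpartition s // ¬ s ∉ P.parts}, ∏ B ∈ P.1.parts, jointCumulant E X B
      = jointCumulant E X s := by
    let _ : Unique {P : Finpartition s // ¬ s ∉ P.parts} :=
      { default := ⟨P₀, by simp [P₀]⟩
        uniq := fun P => Subtype.ext (Finpartition.ext (by
          rw [key P.1 (not_not.1 P.2)]; simp [P₀])) }
    have hd : (default : {P : Finpartition s // ¬ s ∉ P.parts}).1.parts = {s} :=
      key _ (not_not.1 (default : {P : Finpartition s // ¬ s ∉ P.parts}).2)
    rw [Fintype.sum_unique, hd, Finset.prod_singleton]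
  rw [← Fintype.sum_subtype_add_sum_subtype (fun P : Finpartition s => s ∉ P.parts), h1,
    jointCumulant.eq_1 E X s]
  simp only [Finset.prod_attach _ (fun B => jointCumulant E X B)]
  ring

/-- The disjoint cumulant `k^•(Σ_{π_1}, …, Σ_{π_r})` with respect to a representation `ρ` of `S_n`:
the cumulant, for the disjoint product, of the normalized conjugacy classes. -/
noncomputable def disjointCumulant {n r : ℕ} {V : Type*} [AddCommGroup V] [Module ℂ V]
    (ρ : Representation ℂ (Equiv.Perm (Fin n)) V) (l : Fin r → ℕ)
    (π : (i : Fin r) → Equiv.Perm (Fin (l i))) : ℂ :=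
  jointCumulant (charExpectation ρ) (fun i => conjClassSum n (π i)) Finset.univ

/-! ### Colorings of cycles and transitive factorizations -/

/-- `|σ|`: the minimal number of factors needed to write `σ` as a product of transpositions. -/
noncomputable def reflectionLength {X : Type*} [DecidableEq X] (σ : Equiv.Perm X) : ℕ :=
  sInf {k | ∃ L : List (Equiv.Perm X), L.length = k ∧ (∀ τ ∈ L, τ.IsSwap) ∧ L.prod = σ}

/-- `C(σ)`: the set of cycles of `σ`, fixed points included. -/
abbrev Cycles {X : Type*} (σ : Equiv.Perm X) : Type _ :=
  Quotient (Equiv.Perm.SameCycle.setoid σ)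

/-- A coloring of the cycles of `σ₁` (by columns) and of the cycles of `σ₂` (by rows) is compatible
with `λ` if for intersecting cycles `c₁`, `c₂` the box in column `h(c₁)` and row `h(c₂)` belongs to
`λ`. -/
def Compatible {X : Type*} (lam : YoungDiagram) (σ₁ σ₂ : Equiv.Perm X)
    (h : Cycles σ₁ ⊕ Cycles σ₂ → ℕ) : Prop :=
  ∀ (c₁ : Cycles σ₁) (c₂ : Cycles σ₂),
    (∃ x : X, Quotient.mk _ x = c₁ ∧ Quotient.mk _ x = c₂) →
      (h (Sum.inr c₂), h (Sum.inl c₁)) ∈ lam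

/-- `N^λ(σ₁, σ₂)`: the number of compatible colorings. -/
noncomputable def colorings {X : Type*} (lam : YoungDiagram) (σ₁ σ₂ : Equiv.Perm X) : ℕ :=
  Nat.card {h : Cycles σ₁ ⊕ Cycles σ₂ → ℕ // Compatible lam σ₁ σ₂ h}

/-- `σ₁`, `σ₂` and `S_{l_1} × ⋯ × S_{l_r}` together act transitively on the disjoint union of the
sets `{1, …, l_i}`, which stands for `{1, …, l_1 + ⋯ + l_r}`. -/
def ActTransitively {r : ℕ} (l : Fin r → ℕ) (σ₁ σ₂ : Equiv.Perm (Σ i, Fin (l i))) : Prop :=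
  MulAction.IsPretransitive
    (Subgroup.closure ({σ₁, σ₂} ∪
      Set.range (Equiv.Perm.sigmaCongrRightHom fun i => Fin (l i))))
    (Σ i, Fin (l i))

/-!
A scalar multiple of the trace of `g` on the left ideal generated by the Young symmetrizer `c` is
the sum of the coefficients of `c` on the conjugates of `g⁻¹`, because `c` is quasi-idempotent. The
coefficient of `c` at `π` is the signed number of factorizations `π = σ₁ σ₂` in which `σ₁` preserves
the columns and `σ₂` the rows of the tableau, so the expectation of `Σ_π` counts, with signs,
factorizations of `π` together with an injective placement of the points into boxes of `λ`. The
condition that the placement be injective can be dropped: if it sends two points to the same box,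
then `(σ₁, σ₂) ↦ (σ₁ τ, τ σ₂)` with their transposition `τ` cancels its factorizations in pairs.
What remains is the sum of `(-1)^|σ₁| N^λ(σ₁, σ₂)` over all factorizations.

The disjoint product of the `Σ_{π_i}` is the class sum of the product permutation, so the moments
are sums of this kind. Their terms are multiplicative over the connected components of the set of
indices, two indices being connected if `σ₁` or `σ₂` maps a point of one block to the other, and
splitting off the component of a marked index is the recursion that determines the cumulants.
Hence the cumulant collects the connected factorizations, and connected means transitive because
each `S_{l_i}` is transitive on its block.
-/

/-! ### Young symmetrizers -/

section Tableau

variable {n : ℕ} {lam : YoungDiagram} (T : Fin n ≃ lam.cells)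

theorem tableau_ext {x y : Fin n} (hrow : (T x).1.1 = (T y).1.1) (hcol : (T x).1.2 = (T y).1.2) :
    x = y :=
  T.injective (Subtype.ext (Prod.ext hrow hcol))

theorem card_col_eq_and_le_row (i j : ℕ) :
    Finset.card {x | (T x).1.2 = j ∧ i ≤ (T x).1.1} = lam.colLen j - i := by
  rw [← Nat.card_Ico]
  refine Finset.card_nbij (fun x => (T x).1.1) (fun x hx => ?_) (fun x hx y hy hxy => ?_)
    fun k hk => ?_
  · obtain ⟨rfl, hi⟩ : (T x).1.2 = j ∧ i ≤ (T x).1.1 := by simpa using hx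
    exact Finset.mem_Ico.2 ⟨hi, YoungDiagram.mem_iff_lt_colLen.1 (T x).2⟩
  · simp only [Finset.coe_filter, Finset.mem_univ, true_and, Set.mem_ofPred_eq] at hx hy
    exact tableau_ext T hxy (hx.1.trans hy.1.symm)
  · obtain ⟨hi, hk⟩ : i ≤ k ∧ k < lam.colLen j := by simpa using hk
    exact ⟨T.symm ⟨(k, j), YoungDiagram.mem_iff_lt_colLen.2 hk⟩, by simp [hi], by simp⟩

variable {g : Equiv.Perm (Fin n)}

theorem colLen_sub_le_card
    (hg : ∀ x y, (T x).1.1 = (T y).1.1 → (T (g x)).1.2 = (T (g y)).1.2 → x = y) (i j : ℕ) :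
    lam.colLen j - i ≤ Finset.card {x | (T (g x)).1.2 = j ∧ i ≤ (T x).1.1} := by
  have card_col : Finset.card {x | (T (g x)).1.2 = j} = lam.colLen j := by
    rw [← Nat.sub_zero (lam.colLen j), ← card_col_eq_and_le_row T 0 j]
    exact Finset.card_equiv g (by simp)
  have card_low : Finset.card {x | (T (g x)).1.2 = j ∧ ¬ i ≤ (T x).1.1} ≤ i := by
    rw [← Finset.card_range i]
    refine Finset.card_le_card_of_injOn (fun x => (T x).1.1) (fun x hx => ?_)
      fun x hx y hy hxy => ?_
    · simpa using (Finset.mem_filter.1 hx).2.2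
    · simp only [Finset.coe_filter, Finset.mem_univ, true_and, Set.mem_ofPred_eq] at hx hy
      exact hg x y hxy (hx.1.trans hy.1.symm)
  rw [← card_col, ← Finset.card_filter_add_card_filter_not (fun x => i ≤ (T x).1.1),
    Finset.filter_filter, Finset.filter_filter]
  omega

/-- For every threshold `i`, the set `{x | col (g x) = j}` has at least as many entries in the rows
`≥ i` as the column `j` has. The totals over all `j` agree, so these numbers are equal, and both
vanish if the box `(i, j)` is missing. -/
theorem row_col_mem_of_injective
    (hg : ∀ x y, (T x).1.1 = (T y).1.1 → (T (g x)).1.2 = (T (g y)).1.2 → x = y) (x : Fin n) :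
    ((T x).1.1, (T (g x)).1.2) ∈ lam := by
  by_contra hx
  set i := (T x).1.1
  let J : Finset ℕ := Finset.univ.image fun y => (T y).1.2
  have hlt : ∑ j ∈ J, (lam.colLen j - i)
      < ∑ j ∈ J, Finset.card {y | (T (g y)).1.2 = j ∧ i ≤ (T y).1.1} := by
    refine Finset.sum_lt_sum (fun j _ => colLen_sub_le_card T hg i j)
      ⟨(T (g x)).1.2, by simp [J], ?_⟩
    rw [YoungDiagram.mem_iff_lt_colLen, not_lt] at hx
    rw [Nat.sub_eq_zero_of_le hx, Finset.card_pos]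
    exact ⟨x, by simp [i]⟩
  have hfiber (h : Equiv.Perm (Fin n)) :
      ∑ j ∈ J, Finset.card {y | (T (h y)).1.2 = j ∧ i ≤ (T y).1.1}
        = Finset.card {y | i ≤ (T y).1.1} := by
    rw [Finset.card_eq_sum_card_fiberwise (f := fun y => (T (h y)).1.2) (t := J)
      (by simp [Set.MapsTo, J])]
    simp only [Finset.filter_filter, and_comm]
  simp only [← card_col_eq_and_le_row T] at hlt
  exact hlt.ne ((hfiber 1).trans (hfiber g).symm)

theorem exists_eq_col_mul_row
    (hg : ∀ x y, (T x).1.1 = (T y).1.1 → (T (g x)).1.2 = (T (g y)).1.2 → x = y) :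
    ∃ q p, PreservesCols T q ∧ PreservesRows T p ∧ g = q * p := by
  let p₀ (x : Fin n) : Fin n := T.symm ⟨((T x).1.1, (T (g x)).1.2), row_col_mem_of_injective T hg x⟩
  have hrow (x) : (T (p₀ x)).1.1 = (T x).1.1 := by simp [p₀]
  have hcol (x) : (T (p₀ x)).1.2 = (T (g x)).1.2 := by simp [p₀]
  have hinj : Function.Injective p₀ := fun x y hxy =>
    hg x y (by rw [← hrow, hxy, hrow]) (by rw [← hcol, hxy, hcol])
  let p : Equiv.Perm (Fin n) := Equiv.ofBijective p₀ (Finite.injective_iff_bijective.1 hinj)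
  refine ⟨g * p⁻¹, p, p.forall_congr_right.1 fun x => ?_, hrow, by simp⟩
  rw [← Equiv.Perm.mul_apply, inv_mul_cancel_right]
  exact (hcol x).symm

theorem single_mul_rowSymmetrizer {p : Equiv.Perm (Fin n)} (hp : PreservesRows T p) :
    MonoidAlgebra.single p 1 * rowSymmetrizer T = rowSymmetrizer T := by
  classical
  rw [rowSymmetrizer, Finset.mul_sum]
  simp only [MonoidAlgebra.single_mul_single, mul_one]
  refine Finset.sum_equiv (Equiv.mulLeft p) (fun σ => ?_) fun σ _ => rfl
  simp only [Finset.mem_filter, Finset.mem_univ, true_and]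
  exact forall_congr' fun x => by simp [hp (σ x)]

theorem colAntisymmetrizer_mul_single {q : Equiv.Perm (Fin n)} (hq : PreservesCols T q) :
    colAntisymmetrizer T * MonoidAlgebra.single q 1
      = ((Equiv.Perm.sign q : ℤ) : ℂ) • colAntisymmetrizer T := by
  classical
  rw [colAntisymmetrizer, Finset.sum_mul, Finset.smul_sum]
  simp only [MonoidAlgebra.single_mul_single, mul_one, MonoidAlgebra.smul_single, smul_eq_mul]
  refine Finset.sum_equiv (Equiv.mulRight q) (fun σ => ?_) fun σ _ => ?_
  · simp only [Finset.mem_filter, Finset.mem_univ, true_and]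
    exact q.forall_congr_right.symm.trans (forall_congr' fun x => by simp [hq x])
  · have hsq : ((Equiv.Perm.sign q : ℤ) : ℂ) * ((Equiv.Perm.sign q : ℤ) : ℂ) = 1 := by
      rw [← Int.cast_mul]; simp
    simp only [Equiv.coe_mulRight, Equiv.Perm.sign_mul, Units.val_mul, Int.cast_mul]
    rw [mul_left_comm, hsq, mul_one]

theorem apply_swap_of_eq {X Y : Type*} [DecidableEq X] {f : X → Y} {x y : X} (h : f x = f y)
    (z : X) : f (Equiv.swap x y z) = f z := by
  rw [Equiv.swap_apply_def]
  split_ifs with hx hy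
  · rw [hx, h]
  · rw [hy, h]
  · rfl

/-- The transposition `(x y)` is absorbed by `a` and the transposition `(g x g y)` by `b` up to a
sign, so the product equals its own negative. -/
theorem col_mul_single_mul_row_eq_zero {x y : Fin n} (hrow : (T x).1.1 = (T y).1.1)
    (hcol : (T (g x)).1.2 = (T (g y)).1.2) (hxy : x ≠ y) :
    colAntisymmetrizer T * MonoidAlgebra.single g 1 * rowSymmetrizer T = 0 := by
  have hp : PreservesRows T (Equiv.swap x y) := apply_swap_of_eq (f := fun z => (T z).1.1) hrow
  have hq : PreservesCols T (Equiv.swap (g x) (g y)) :=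
    apply_swap_of_eq (f := fun z => (T z).1.2) hcol
  have hcomm : MonoidAlgebra.single g 1 * MonoidAlgebra.single (Equiv.swap x y) 1
      = MonoidAlgebra.single (Equiv.swap (g x) (g y)) 1 * MonoidAlgebra.single g (1 : ℂ) := by
    rw [MonoidAlgebra.single_mul_single, MonoidAlgebra.single_mul_single,
      Equiv.mul_swap_eq_swap_mul]
  have : IsAddTorsionFree (MonoidAlgebra ℂ (Equiv.Perm (Fin n))) := .of_module_rat _
  rw [← self_eq_neg]
  calc colAntisymmetrizer T * MonoidAlgebra.single g 1 * rowSymmetrizer T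
      = colAntisymmetrizer T * (MonoidAlgebra.single g 1 * MonoidAlgebra.single (Equiv.swap x y) 1)
          * rowSymmetrizer T := by
        conv_lhs => rw [← single_mul_rowSymmetrizer T hp]
        simp only [mul_assoc]
    _ = colAntisymmetrizer T * MonoidAlgebra.single (Equiv.swap (g x) (g y)) 1
          * MonoidAlgebra.single g 1 * rowSymmetrizer T := by
        rw [hcomm, ← mul_assoc (colAntisymmetrizer T)]
    _ = -(colAntisymmetrizer T * MonoidAlgebra.single g 1 * rowSymmetrizer T) := by
        rw [colAntisymmetrizer_mul_single T hq, Equiv.Perm.sign_swap (g.injective.ne hxy)]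
        simp

theorem exists_col_mul_mul_row_eq_smul (y : MonoidAlgebra ℂ (Equiv.Perm (Fin n))) :
    ∃ α : ℂ, colAntisymmetrizer T * y * rowSymmetrizer T = α • youngSymmetrizer T := by
  suffices hy : colAntisymmetrizer T * y * rowSymmetrizer T ∈ ℂ ∙ youngSymmetrizer T by
    simpa only [eq_comm] using Submodule.mem_span_singleton.1 hy
  induction y using MonoidAlgebra.induction_linear with
  | zero => simp
  | add y z hy hz => simpa only [mul_add, add_mul] using add_mem hy hz
  | single g r =>
    rw [← mul_one r, ← MonoidAlgebra.smul_single', mul_smul_comm, smul_mul_assoc]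
    refine Submodule.smul_mem _ r ?_
    by_cases hg : ∀ x y, (T x).1.1 = (T y).1.1 → (T (g x)).1.2 = (T (g y)).1.2 → x = y
    · obtain ⟨q, p, hq, hp, rfl⟩ := exists_eq_col_mul_row T hg
      rw [← one_mul (1 : ℂ), ← MonoidAlgebra.single_mul_single, ← mul_assoc,
        colAntisymmetrizer_mul_single T hq, mul_assoc, single_mul_rowSymmetrizer T hp,
        smul_mul_assoc]
      exact Submodule.smul_mem _ _ (Submodule.mem_span_singleton_self _)
    · push Not at hg
      obtain ⟨x, y, hrow, hcol, hxy⟩ := hg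
      rw [col_mul_single_mul_row_eq_zero T hrow hcol hxy]
      exact zero_mem _

theorem exists_youngSymmetrizer_mul_self_eq_smul :
    ∃ α : ℂ, youngSymmetrizer T * youngSymmetrizer T = α • youngSymmetrizer T := by
  simpa only [youngSymmetrizer, mul_assoc] using
    exists_col_mul_mul_row_eq_smul T (rowSymmetrizer T * colAntisymmetrizer T)

end Tableau

/-! ### The irreducible character -/

/-- The filling `f : X → lam.cells` of the diagram is adapted to the pair `(σ₁, σ₂)` if its column
is constant on the cycles of `σ₁` and its row is constant on the cycles of `σ₂`. Coloring each
cycle accordingly turns adapted fillings into compatible colorings. -/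
def Adapted {X : Type*} {lam : YoungDiagram} (σ : Equiv.Perm X × Equiv.Perm X)
    (f : X → lam.cells) : Prop :=
  (∀ x, (f (σ.1 x)).1.2 = (f x).1.2) ∧ ∀ x, (f (σ.2 x)).1.1 = (f x).1.1

open scoped Classical in
/-- The signed number of factorizations `σ₁ σ₂ = π` to which `f` is adapted. If `f` is a tableau,
this is the coefficient of `π` in the Young symmetrizer. -/
noncomputable def factorizationSum {X : Type*} [Fintype X] [DecidableEq X] {lam : YoungDiagram}
    (π : Equiv.Perm X) (f : X → lam.cells) : ℂ :=
  ∑ σ : Equiv.Perm X × Equiv.Perm X with σ.1 * σ.2 = π ∧ Adapted σ f,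
    ((Equiv.Perm.sign σ.1 : ℤ) : ℂ)

theorem Adapted.apply_eq_of_mul_apply_eq {X : Type*} {lam : YoungDiagram}
    {σ : Equiv.Perm X × Equiv.Perm X} {f : X → lam.cells} (hσ : Adapted σ f)
    (hf : Function.Injective f) {x : X} (hx : (σ.1 * σ.2) x = x) : σ.1 x = x ∧ σ.2 x = x := by
  have hcol : (f (σ.2 x)).1.2 = (f x).1.2 := by rw [← hσ.1, ← Equiv.Perm.mul_apply, hx]
  have hx₂ : σ.2 x = x := hf (Subtype.ext (Prod.ext (hσ.2 x) hcol))
  exact ⟨by rwa [Equiv.Perm.mul_apply, hx₂] at hx, hx₂⟩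

theorem factorizationSum_one_of_injective {X : Type*} [Fintype X] [DecidableEq X]
    {lam : YoungDiagram} {f : X → lam.cells} (hf : Function.Injective f) :
    factorizationSum 1 f = 1 := by
  have htriv (σ : Equiv.Perm X × Equiv.Perm X) : σ.1 * σ.2 = 1 ∧ Adapted σ f ↔ σ = 1 := by
    refine ⟨fun ⟨hmul, hσ⟩ => ?_, ?_⟩
    · have hfix (x) := hσ.apply_eq_of_mul_apply_eq hf (x := x) (by rw [hmul, Equiv.Perm.one_apply])
      exact Prod.ext (Equiv.ext fun x => (hfix x).1) (Equiv.ext fun x => (hfix x).2)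
    · rintro rfl
      exact ⟨one_mul 1, fun _ => rfl, fun _ => rfl⟩
  simp only [factorizationSum, htriv, Finset.filter_eq', Finset.mem_univ, if_true]
  simp

section Character

variable {n : ℕ} {lam : YoungDiagram} (T : Fin n ≃ lam.cells)

theorem coeff_youngSymmetrizer (u : Equiv.Perm (Fin n)) :
    (youngSymmetrizer T).coeff u = factorizationSum u T := by
  classical
  simp only [youngSymmetrizer, colAntisymmetrizer, rowSymmetrizer, Finset.sum_mul_sum,
    ← Finset.sum_product', MonoidAlgebra.single_mul_single, mul_one, MonoidAlgebra.coeff_sum,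
    Finsupp.coe_finsetSum, Finset.sum_apply, MonoidAlgebra.coeff_single, Finsupp.single_apply]
  rw [← Finset.sum_filter, factorizationSum]
  refine Finset.sum_congr (Finset.ext fun σ => ?_) fun _ _ => rfl
  simp only [Finset.mem_filter, Finset.mem_product, Finset.mem_univ, true_and]
  exact and_comm

theorem trace_mulLeft_single_comp_mulRight {R G : Type*} [CommRing R] [Group G] [Fintype G]
    (g : G) (c : MonoidAlgebra R G) :
    LinearMap.trace R (MonoidAlgebra R G)
        (LinearMap.mulLeft R (MonoidAlgebra.single g 1) ∘ₗ LinearMap.mulRight R c)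
      = ∑ h, c.coeff (h⁻¹ * g⁻¹ * h) := by
  classical
  rw [LinearMap.trace_eq_matrix_trace R (MonoidAlgebra.basis G R), Matrix.trace]
  refine Finset.sum_congr rfl fun h _ => ?_
  rw [Matrix.diag_apply, LinearMap.toMatrix_apply]
  change (MonoidAlgebra.single g 1 * (MonoidAlgebra.single h 1 * c)).coeff h = _
  simp [mul_assoc]

/-- On `ℂ[S_n] c`, right multiplication by `c` is the scalar `α` of `c * c = α • c`, and it maps
all of `ℂ[S_n]` there, so the trace can be computed on `ℂ[S_n]`. -/
theorem exists_mul_trace_youngRep : ∃ α : ℂ, ∀ g, α * LinearMap.trace ℂ _ (youngRep T g)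
    = ∑ h, factorizationSum (h⁻¹ * g⁻¹ * h) T := by
  obtain ⟨α, hα⟩ := exists_youngSymmetrizer_mul_self_eq_smul T
  refine ⟨α, fun g => ?_⟩
  set c := youngSymmetrizer T
  let F := LinearMap.mulLeft ℂ (MonoidAlgebra.single g 1) ∘ₗ LinearMap.mulRight ℂ c
  have hF (x) : F x ∈ youngModule T := ⟨MonoidAlgebra.single g 1 * x, mul_assoc _ _ _⟩
  have hrestrict : F.restrict (fun x _ => hF x) = α • youngRep T g := by
    ext1 ⟨_, z, rfl⟩
    refine Subtype.ext ?_
    change MonoidAlgebra.single g 1 * (z * c * c) = α • (MonoidAlgebra.single g 1 * (z * c))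
    rw [mul_assoc z, hα, mul_smul_comm, mul_smul_comm]
  have htrace := LinearMap.trace_restrict_eq_of_forall_mem (youngModule T) F hF
  rw [hrestrict, map_smul, smul_eq_mul] at htrace
  simp only [htrace, F, trace_mulLeft_single_comp_mulRight, c, coeff_youngSymmetrizer]

theorem trace_perm_inv {X k V : Type*} [Finite X] [Field k] [AddCommGroup V] [Module k V]
    (ρ : Representation k (Equiv.Perm X) V) (g : Equiv.Perm X) :
    LinearMap.trace k V (ρ g⁻¹) = LinearMap.trace k V (ρ g) := by
  classical
  have := Fintype.ofFinite X
  have hconj : IsConj g g⁻¹ :=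
    Equiv.Perm.isConj_iff_cycleType_eq.2 (Equiv.Perm.cycleType_inv g).symm
  obtain ⟨c, hc⟩ := isConj_iff.1 hconj
  rw [← hc]
  exact ρ.char_conj g c

theorem normalizedCharacter_youngRep (g : Equiv.Perm (Fin n)) :
    normalizedCharacter (youngRep T) g
      = (n.factorial : ℂ)⁻¹ * ∑ h, factorizationSum (h⁻¹ * g * h) T := by
  obtain ⟨α, hα⟩ := exists_mul_trace_youngRep T
  have hone : α * LinearMap.trace ℂ _ (youngRep T 1) = n.factorial := by
    rw [hα]
    simp [factorizationSum_one_of_injective T.injective, Fintype.card_perm]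
  have hα₀ : α ≠ 0 := left_ne_zero_of_mul (hone ▸ Nat.cast_ne_zero.2 n.factorial_ne_zero)
  rw [normalizedCharacter, ← mul_div_mul_left _ _ hα₀, hone, ← trace_perm_inv, hα, inv_inv,
    div_eq_inv_mul]

end Character

/-! ### The expectation of a class sum -/

section ViaEmbedding

variable {X α : Type*} [Fintype X] [DecidableEq α]

theorem viaFintypeEmbedding_eq_iff {π : Equiv.Perm X} {f : X ↪ α} {g : Equiv.Perm α} :
    π.viaFintypeEmbedding f = g ↔ (∀ x, g (f x) = f (π x)) ∧ ∀ a ∉ Set.range f, g a = a := by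
  constructor
  · rintro rfl
    exact ⟨fun x => π.viaFintypeEmbedding_apply_image f x,
      fun a ha => π.viaFintypeEmbedding_apply_notMem_range f ha⟩
  · rintro ⟨himage, hfix⟩
    ext a
    by_cases ha : a ∈ Set.range f
    · obtain ⟨x, rfl⟩ := ha
      rw [Equiv.Perm.viaFintypeEmbedding_apply_image, himage]
    · rw [Equiv.Perm.viaFintypeEmbedding_apply_notMem_range _ _ ha, hfix a ha]

theorem viaFintypeEmbedding_injective (f : X ↪ α) :
    Function.Injective fun π : Equiv.Perm X => π.viaFintypeEmbedding f :=
  fun _ _ h => Equiv.Perm.extendDomainHom_injective f.toEquivRange h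

theorem viaFintypeEmbedding_mul (σ τ : Equiv.Perm X) (f : X ↪ α) :
    (σ * τ).viaFintypeEmbedding f = σ.viaFintypeEmbedding f * τ.viaFintypeEmbedding f :=
  (Equiv.Perm.extendDomain_mul f.toEquivRange σ τ).symm

theorem exists_viaFintypeEmbedding_eq {f : X ↪ α} {g : Equiv.Perm α}
    (hg : ∀ a ∉ Set.range f, g a = a) : ∃ π : Equiv.Perm X, π.viaFintypeEmbedding f = g := by
  have hmem (x : X) : ∃ y, f y = g (f x) := by
    by_contra h
    exact h ⟨x, (g.injective (hg _ h)).symm⟩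
  choose p hp using hmem
  have hinj : Function.Injective p := fun x y hxy =>
    f.injective (g.injective (by rw [← hp, hxy, hp]))
  exact ⟨Equiv.ofBijective p (Finite.injective_iff_bijective.1 hinj),
    viaFintypeEmbedding_eq_iff.2 ⟨fun x => (hp x).symm, hg⟩⟩

theorem viaFintypeEmbedding_trans_perm (π : Equiv.Perm X) (f : X ↪ α) (g : Equiv.Perm α) :
    π.viaFintypeEmbedding (f.trans g.toEmbedding) = g * π.viaFintypeEmbedding f * g⁻¹ := by
  refine viaFintypeEmbedding_eq_iff.2 ⟨fun x => by simp, g.forall_congr_right.1 fun a ha => ?_⟩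
  have ha' : a ∉ Set.range f := fun ⟨x, hx⟩ => ha ⟨x, congrArg g hx⟩
  simp [Equiv.Perm.viaFintypeEmbedding_apply_notMem_range _ _ ha']

theorem forall_apply_viaFintypeEmbedding_eq_iff {Y : Type*} (k : α → Y) {π : Equiv.Perm X}
    {f : X ↪ α} :
    (∀ a, k (π.viaFintypeEmbedding f a) = k a) ↔ ∀ x, k (f (π x)) = k (f x) := by
  refine ⟨fun h x => by rw [← h (f x), Equiv.Perm.viaFintypeEmbedding_apply_image], fun h a => ?_⟩
  by_cases ha : a ∈ Set.range f
  · obtain ⟨x, rfl⟩ := ha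
    rw [Equiv.Perm.viaFintypeEmbedding_apply_image, h]
  · rw [Equiv.Perm.viaFintypeEmbedding_apply_notMem_range _ _ ha]

theorem factorizationSum_viaFintypeEmbedding [Fintype α] [DecidableEq X] {lam : YoungDiagram}
    {F : α → lam.cells} (hF : Function.Injective F) (π : Equiv.Perm X) (f : X ↪ α) :
    factorizationSum (π.viaFintypeEmbedding f) F = factorizationSum π (F ∘ f) := by
  classical
  have hadapted (σ : Equiv.Perm X × Equiv.Perm X) :
      Adapted (σ.1.viaFintypeEmbedding f, σ.2.viaFintypeEmbedding f) F ↔ Adapted σ (F ∘ f) :=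
    and_congr (forall_apply_viaFintypeEmbedding_eq_iff fun a => (F a).1.2)
      (forall_apply_viaFintypeEmbedding_eq_iff fun a => (F a).1.1)
  refine (Finset.sum_bij
    (fun σ _ => (σ.1.viaFintypeEmbedding f, σ.2.viaFintypeEmbedding f)) ?_ ?_ ?_ ?_).symm
  · intro σ hσ
    obtain ⟨hmul, hσ⟩ := (Finset.mem_filter_univ _).1 hσ
    exact (Finset.mem_filter_univ _).2 ⟨by rw [← viaFintypeEmbedding_mul, hmul], (hadapted σ).2 hσ⟩
  · intro σ _ τ _ h
    exact Prod.ext (viaFintypeEmbedding_injective f (congrArg Prod.fst h))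
      (viaFintypeEmbedding_injective f (congrArg Prod.snd h))
  · rintro ⟨ρ₁, ρ₂⟩ hρ
    obtain ⟨hmul, hρ⟩ := (Finset.mem_filter_univ _).1 hρ
    have hfix (a) (ha : a ∉ Set.range f) := hρ.apply_eq_of_mul_apply_eq hF (x := a)
      (by rw [hmul, Equiv.Perm.viaFintypeEmbedding_apply_notMem_range _ _ ha])
    obtain ⟨σ₁, rfl⟩ := exists_viaFintypeEmbedding_eq fun a ha => (hfix a ha).1
    obtain ⟨σ₂, rfl⟩ := exists_viaFintypeEmbedding_eq fun a ha => (hfix a ha).2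
    rw [← viaFintypeEmbedding_mul] at hmul
    exact ⟨(σ₁, σ₂), (Finset.mem_filter_univ _).2
      ⟨viaFintypeEmbedding_injective f hmul, (hadapted (σ₁, σ₂)).1 hρ⟩, rfl⟩
  · intro σ _
    rw [Equiv.Perm.viaFintypeEmbedding_sign]

end ViaEmbedding

section SignedColorings

variable {X : Type*} [Fintype X] [DecidableEq X] {lam : YoungDiagram}

/-- If `f x = f y` then `(σ₁, σ₂) ↦ (σ₁ (x y), (x y) σ₂)` is a sign reversing involution. -/
theorem factorizationSum_eq_zero_of_not_injective (π : Equiv.Perm X) {f : X → lam.cells}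
    (hf : ¬ Function.Injective f) : factorizationSum π f = 0 := by
  classical
  obtain ⟨x, y, hxy, hne⟩ := Function.not_injective_iff.1 hf
  refine Finset.sum_involution
    (fun σ _ => (σ.1 * Equiv.swap x y, Equiv.swap x y * σ.2)) ?_ ?_ ?_ ?_
  · intro σ _
    simp [Equiv.Perm.sign_swap hne]
  · intro σ _ _ h
    exact hne (Equiv.swap_eq_one_iff.1 (mul_eq_left.1 (congrArg Prod.fst h)))
  · intro σ hσ
    obtain ⟨hmul, hcol, hrow⟩ := (Finset.mem_filter_univ _).1 hσ
    refine (Finset.mem_filter_univ _).2 ⟨?_, fun z => ?_, fun z => ?_⟩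
    · rw [mul_assoc, Equiv.swap_mul_self_mul, hmul]
    · rw [Equiv.Perm.mul_apply, hcol, apply_swap_of_eq hxy]
    · rw [Equiv.Perm.mul_apply, apply_swap_of_eq hxy, hrow]
  · intro σ _
    simp [mul_assoc]

theorem eq_of_sameCycle_of_apply_eq {X Y : Type*} {σ : Equiv.Perm X} (k : X → Y)
    (hk : ∀ x, k (σ x) = k x) {x y : X} (hxy : σ.SameCycle x y) : k x = k y := by
  obtain ⟨i, rfl⟩ := hxy
  induction i using Int.induction_on with
  | zero => simp
  | succ i ih => rw [ih, add_comm, zpow_one_add, Equiv.Perm.mul_apply, hk]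
  | pred i ih => rw [ih, ← hk ((σ ^ (-(i : ℤ) - 1)) x), ← Equiv.Perm.mul_apply, ← zpow_one_add,
      add_sub_cancel]

theorem colorings_eq_card_adapted {X : Type*} (σ : Equiv.Perm X × Equiv.Perm X) :
    colorings lam σ.1 σ.2 = Nat.card {f : X → lam.cells // Adapted σ f} := by
  refine Nat.card_congr
    { toFun h := ⟨fun x => ⟨(h.1 (.inr ⟦x⟧), h.1 (.inl ⟦x⟧)), h.2 _ _ ⟨x, rfl, rfl⟩⟩,
        fun x => congrArg (h.1 <| .inl ·) (Quotient.sound ?_),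
        fun x => congrArg (h.1 <| .inr ·) (Quotient.sound ?_)⟩
      invFun f := ⟨Sum.elim
        (Quotient.lift _ fun _ _ => eq_of_sameCycle_of_apply_eq (fun x => (f.1 x).1.2) f.2.1)
        (Quotient.lift _ fun _ _ => eq_of_sameCycle_of_apply_eq (fun x => (f.1 x).1.1) f.2.2), ?_⟩
      left_inv h := Subtype.ext (funext ?_)
      right_inv f := rfl }
  · exact Equiv.Perm.sameCycle_apply_left.2 (Equiv.Perm.SameCycle.refl _ _)
  · exact Equiv.Perm.sameCycle_apply_left.2 (Equiv.Perm.SameCycle.refl _ _)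
  · rintro _ _ ⟨x, rfl, rfl⟩
    exact (f.1 x).2
  · rintro (q | q) <;> induction q using Quotient.inductionOn <;> rfl

/-- The summand `(-1)^|σ₁| N^λ(σ₁, σ₂)` of the main theorem. -/
noncomputable def signedColorings (lam : YoungDiagram) (σ : Equiv.Perm X × Equiv.Perm X) : ℂ :=
  (-1) ^ reflectionLength σ.1 * colorings lam σ.1 σ.2

theorem neg_one_pow_reflectionLength {R : Type*} [Ring R] (σ : Equiv.Perm X) :
    (-1 : R) ^ reflectionLength σ = ((Equiv.Perm.sign σ : ℤ) : R) := by
  have hne : {k | ∃ L : List (Equiv.Perm X),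
      L.length = k ∧ (∀ τ ∈ L, τ.IsSwap) ∧ L.prod = σ}.Nonempty := by
    obtain ⟨L, hprod, hswap⟩ := (Equiv.Perm.truncSwapFactors σ).out
    exact ⟨L.length, L, rfl, hswap, hprod⟩
  obtain ⟨L, hlen, hswap, hprod⟩ := Nat.sInf_mem hne
  rw [reflectionLength, ← hlen, ← hprod, Equiv.Perm.sign_prod_list_swap hswap]
  simp

theorem signedColorings_eq_sign_mul_card (σ : Equiv.Perm X × Equiv.Perm X) :
    signedColorings lam σ
      = (Equiv.Perm.sign σ.1 : ℤ) * (Nat.card {f : X → lam.cells // Adapted σ f} : ℂ) := by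
  rw [signedColorings, neg_one_pow_reflectionLength, colorings_eq_card_adapted]

/-- The signed number of colored factorizations `σ₁ σ₂ = π`: the sum of the main theorem without
the transitivity condition. -/
noncomputable def signedFactorizations (lam : YoungDiagram) (π : Equiv.Perm X) : ℂ :=
  ∑ σ : Equiv.Perm X × Equiv.Perm X with σ.1 * σ.2 = π, signedColorings lam σ

theorem sum_factorizationSum (π : Equiv.Perm X) :
    ∑ f : X → lam.cells, factorizationSum π f = signedFactorizations lam π := by
  classical
  simp only [signedFactorizations, factorizationSum, ← Finset.filter_filter]
  simp only [Finset.sum_filter (Adapted · _)]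
  rw [Finset.sum_comm]
  refine Finset.sum_congr rfl fun σ _ => ?_
  rw [← Finset.sum_filter, Finset.sum_const, nsmul_eq_mul, mul_comm,
    signedColorings_eq_sign_mul_card, Nat.card_eq_fintype_card, Fintype.card_subtype]

end SignedColorings

/-- `PartialPermutation.place` for permutations of an arbitrary finite type, such as the disjoint
union of several sets `{1, …, l_i}`. -/
def PartialPermutation.placeFintype {X α : Type*} [Fintype X] [DecidableEq α] (π : Equiv.Perm X)
    (f : X ↪ α) : PartialPermutation α where
  supp := Finset.univ.map f
  perm := π.viaFintypeEmbedding f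
  fix x hx := Equiv.Perm.viaFintypeEmbedding_apply_notMem_range π f (by simpa using hx)

/-- The normalized conjugacy class `Σ_π` of a permutation of an arbitrary finite type. -/
noncomputable def classSum {X : Type*} [Fintype X] [DecidableEq X] (n : ℕ) (π : Equiv.Perm X) :
    DisjointAlgebra (Fin n) :=
  ∑ f : X ↪ Fin n, DisjointAlgebra.of (PartialPermutation.placeFintype π f)

section Expectation

variable {n : ℕ} {lam : YoungDiagram} (T : Fin n ≃ lam.cells)
  {X : Type*} [Fintype X] [DecidableEq X]

theorem charExpectation_one : charExpectation (youngRep T) 1 = 1 := by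
  change charExpectation (youngRep T) (DisjointAlgebra.of (PartialPermutation.empty (Fin n))) = 1
  rw [charExpectation, DisjointAlgebra.lift_of, normalizedCharacter_youngRep]
  have h₀ : (n.factorial : ℂ) ≠ 0 := Nat.cast_ne_zero.2 n.factorial_ne_zero
  simp [PartialPermutation.empty, factorizationSum_one_of_injective T.injective,
    Fintype.card_perm, h₀]

theorem charExpectation_classSum_eq_sum_embedding (π : Equiv.Perm X) :
    charExpectation (youngRep T) (classSum n π)
      = ∑ f : X ↪ Fin n, factorizationSum (π.viaFintypeEmbedding f) T := by
  have hconj (h : Equiv.Perm (Fin n)) :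
      ∑ f : X ↪ Fin n, factorizationSum (h⁻¹ * π.viaFintypeEmbedding f * h) T
        = ∑ f : X ↪ Fin n, factorizationSum (π.viaFintypeEmbedding f) T := by
    refine Fintype.sum_equiv (Equiv.embeddingCongr (Equiv.refl X) h⁻¹) _ _ fun f => ?_
    have htrans : Equiv.embeddingCongr (Equiv.refl X) h⁻¹ f = f.trans (h⁻¹).toEmbedding := rfl
    rw [htrans, viaFintypeEmbedding_trans_perm, inv_inv]
  have h₀ : (n.factorial : ℂ) ≠ 0 := Nat.cast_ne_zero.2 n.factorial_ne_zero
  simp only [classSum, map_sum, charExpectation, DisjointAlgebra.lift_of,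
    PartialPermutation.placeFintype, normalizedCharacter_youngRep]
  rw [← Finset.mul_sum, Finset.sum_comm, Finset.sum_congr rfl fun h _ => hconj h]
  simp [Fintype.card_perm, h₀]

theorem charExpectation_classSum (π : Equiv.Perm X) :
    charExpectation (youngRep T) (classSum n π) = signedFactorizations lam π := by
  rw [charExpectation_classSum_eq_sum_embedding, ← sum_factorizationSum]
  simp only [factorizationSum_viaFintypeEmbedding T.injective]
  refine Finset.sum_of_injOn (fun f => T ∘ f) (fun f _ g _ h => ?_) (by simp) (fun F _ hF => ?_)
    fun _ _ => rfl
  · exact DFunLike.coe_injective (T.injective.comp_left h)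
  · refine factorizationSum_eq_zero_of_not_injective π fun hinj => hF ?_
    exact ⟨⟨T.symm ∘ F, T.symm.injective.comp hinj⟩, by simp, by ext1 x; simp⟩

end Expectation

/-! ### Disjoint products of class sums -/

section Product

variable {X Y : Type*} [Fintype X] [Fintype Y]

theorem placeFintype_trans_equiv {α : Type*} [DecidableEq α] (e : X ≃ Y) {π : Equiv.Perm X}
    {ρ : Equiv.Perm Y} (h : Function.Semiconj e π ρ) (f : Y ↪ α) :
    PartialPermutation.placeFintype π (e.toEmbedding.trans f)
      = PartialPermutation.placeFintype ρ f := by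
  have hrange : Set.range (e.toEmbedding.trans f) = Set.range f := by
    simp [Function.Embedding.coe_trans]
  ext1
  · ext a
    simpa [PartialPermutation.placeFintype] using Set.ext_iff.1 hrange a
  · refine viaFintypeEmbedding_eq_iff.2 ⟨fun x => ?_, fun a ha => ?_⟩
    · simp [PartialPermutation.placeFintype, Equiv.Perm.viaFintypeEmbedding_apply_image, h.eq]
    · exact Equiv.Perm.viaFintypeEmbedding_apply_notMem_range _ _ (hrange ▸ ha)

theorem comp_placeFintype {α : Type*} [DecidableEq α] (π : Equiv.Perm X) (ρ : Equiv.Perm Y)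
    (F : X ⊕ Y ↪ α) :
    (PartialPermutation.placeFintype π (Function.Embedding.inl.trans F)).comp
        (PartialPermutation.placeFintype ρ (Function.Embedding.inr.trans F))
      = PartialPermutation.placeFintype (Equiv.Perm.sumCongr π ρ) F := by
  have hπ (x) := π.viaFintypeEmbedding_apply_image (Function.Embedding.inl.trans F) x
  have hρ (y) := ρ.viaFintypeEmbedding_apply_image (Function.Embedding.inr.trans F) y
  have hπ' (a) (ha : ∀ x, F (.inl x) ≠ a) := π.viaFintypeEmbedding_apply_notMem_range
    (Function.Embedding.inl.trans F) (b := a) (by simpa using ha)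
  have hρ' (a) (ha : ∀ y, F (.inr y) ≠ a) := ρ.viaFintypeEmbedding_apply_notMem_range
    (Function.Embedding.inr.trans F) (b := a) (by simpa using ha)
  simp only [Function.Embedding.trans_apply, Function.Embedding.inl_apply,
    Function.Embedding.inr_apply] at hπ hρ
  ext1
  · ext a
    simp [PartialPermutation.comp, PartialPermutation.placeFintype]
  · refine (viaFintypeEmbedding_eq_iff.2 ⟨?_, fun a ha => ?_⟩).symm <;>
      simp only [PartialPermutation.comp, PartialPermutation.placeFintype, Equiv.Perm.mul_apply]
    · rintro (x | y)
      · rw [hρ' _ (by simp), hπ, Equiv.Perm.sumCongr_apply, Sum.map_inl]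
      · rw [hρ, hπ' _ (by simp), Equiv.Perm.sumCongr_apply, Sum.map_inr]
    · rw [hρ' a fun y hy => ha ⟨_, hy⟩, hπ' a fun x hx => ha ⟨_, hx⟩]

variable [DecidableEq X] [DecidableEq Y] (n : ℕ)

theorem classSum_congr (e : X ≃ Y) {π : Equiv.Perm X} {ρ : Equiv.Perm Y}
    (h : Function.Semiconj e π ρ) : classSum n π = classSum n ρ :=
  (Fintype.sum_equiv (Equiv.embeddingCongr e.symm (Equiv.refl _)) _ _ fun f =>
    congrArg DisjointAlgebra.of (placeFintype_trans_equiv e h f).symm).symm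

theorem classSum_mul_classSum (π : Equiv.Perm X) (ρ : Equiv.Perm Y) :
    classSum n π * classSum n ρ = classSum n (Equiv.Perm.sumCongr π ρ) := by
  classical
  have hdisjoint (f : X ↪ Fin n) (g : Y ↪ Fin n) :
      Disjoint (PartialPermutation.placeFintype π f).supp
          (PartialPermutation.placeFintype ρ g).supp ↔
        Disjoint (Set.range f) (Set.range g) := by
    rw [← Finset.disjoint_coe]
    simp [PartialPermutation.placeFintype]
  rw [classSum, classSum, Finset.sum_mul_sum, ← Finset.sum_product', Finset.univ_product_univ]
  simp only [DisjointAlgebra.of_mul_of, hdisjoint]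
  rw [← Finset.sum_filter, ← Finset.sum_subtype_eq_sum_filter, Finset.subtype_univ]
  exact (Fintype.sum_equiv Equiv.sumEmbeddingEquivProdEmbeddingDisjoint _ _ fun F =>
    congrArg DisjointAlgebra.of (comp_placeFintype π ρ F).symm).symm

theorem classSum_of_isEmpty [IsEmpty X] (π : Equiv.Perm X) : classSum n π = 1 := by
  rw [classSum, Fintype.sum_unique]
  refine congrArg DisjointAlgebra.of (PartialPermutation.ext ?_ ?_)
  · simp [PartialPermutation.placeFintype, PartialPermutation.empty]
  · exact viaFintypeEmbedding_eq_iff.2 ⟨isEmptyElim, fun _ _ => rfl⟩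

end Product

section Blocks

variable {X ι : Type*} {c : X → ι}

/-- The points whose label belongs to `s`. -/
abbrev Block (c : X → ι) (s : Finset ι) : Type _ :=
  {x // c x ∈ s}

/-- The restriction to a block of a permutation that preserves the labels. -/
def blockPerm {π : Equiv.Perm X} (hπ : ∀ x, c (π x) = c x) (s : Finset ι) :
    Equiv.Perm (Block c s) :=
  π.subtypePerm fun x => by rw [hπ]

variable [DecidableEq ι] {B C : Finset ι}

/-- Splitting a block along a decomposition of its set of labels. -/
def blockSumEquiv (hBC : Disjoint B C) : Block c B ⊕ Block c C ≃ Block c (B ∪ C) :=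
  ((Equiv.subtypeEquivRight fun _ => Finset.mem_union).trans
    (subtypeOrEquiv _ _ (Pi.disjoint_iff.2 fun _ => Prop.disjoint_iff.2
      (not_and.2 fun hB => Finset.disjoint_left.1 hBC hB)))).symm

theorem semiconj_blockSumEquiv {π : Equiv.Perm X} (hπ : ∀ x, c (π x) = c x)
    (hBC : Disjoint B C) :
    Function.Semiconj (blockSumEquiv hBC)
      (Equiv.Perm.sumCongr (blockPerm hπ B) (blockPerm hπ C)) (blockPerm hπ (B ∪ C)) := by
  rintro (x | x) <;> rfl

variable [Fintype X] [DecidableEq X] (n : ℕ)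

theorem classSum_blockPerm_mul {π : Equiv.Perm X} (hπ : ∀ x, c (π x) = c x)
    (hBC : Disjoint B C) :
    classSum n (blockPerm hπ B) * classSum n (blockPerm hπ C)
      = classSum n (blockPerm hπ (B ∪ C)) := by
  rw [classSum_mul_classSum]
  exact classSum_congr n _ (semiconj_blockSumEquiv hπ hBC)

theorem prod_classSum_blockPerm {π : Equiv.Perm X} (hπ : ∀ x, c (π x) = c x) (s : Finset ι) :
    ∏ i ∈ s, classSum n (blockPerm hπ {i}) = classSum n (blockPerm hπ s) := by
  induction s using Finset.induction_on with
  | empty =>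
    have : IsEmpty (Block c ∅) := ⟨fun x => Finset.notMem_empty _ x.2⟩
    rw [Finset.prod_empty, classSum_of_isEmpty]
  | insert i s hi ih =>
    rw [Finset.prod_insert hi, ih, Finset.insert_eq,
      classSum_blockPerm_mul n hπ (Finset.disjoint_singleton_left.2 hi)]

end Blocks

theorem fst_sigmaCongrRight {ι : Type*} {β : ι → Type*} (π : (i : ι) → Equiv.Perm (β i))
    (x : Σ i, β i) : (Equiv.Perm.sigmaCongrRight π x).1 = x.1 :=
  rfl

theorem conjClassSum_eq_classSum_blockPerm {r : ℕ} (n : ℕ) (l : Fin r → ℕ)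
    (π : (i : Fin r) → Equiv.Perm (Fin (l i))) (i : Fin r) :
    conjClassSum n (π i)
      = classSum n (blockPerm (fst_sigmaCongrRight π) {i}) := by
  let e : Fin (l i) ≃ Block (Sigma.fst : (Σ i, Fin (l i)) → Fin r) {i} :=
    (Equiv.sigmaSubtype (β := fun i => Fin (l i)) i).symm.trans
      (Equiv.subtypeEquivRight fun _ => Finset.mem_singleton.symm)
  exact classSum_congr n e fun x => rfl

/-! ### Splitting off a block of a set partition -/

section Cumulants

variable {ι : Type*} [DecidableEq ι] {s B : Finset ι} {a : ι}

theorem parts_avoid_of_mem (P : Finpartition s) (hB : B ∈ P.parts) :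
    (P.avoid B).parts = P.parts.erase B := by
  have hsdiff (D) (hD : D ∈ P.parts) (hne : D ≠ B) : D \ B = D :=
    Finset.sdiff_eq_self_of_disjoint (P.disjoint hD hB hne)
  ext C
  rw [Finpartition.mem_avoid, Finset.mem_erase]
  constructor
  · rintro ⟨D, hD, hle, rfl⟩
    have hne : D ≠ B := fun h => hle h.le
    rw [hsdiff D hD hne]
    exact ⟨hne, hD⟩
  · rintro ⟨hne, hC⟩
    refine ⟨C, hC, fun hle => hne ?_, hsdiff C hC hne⟩
    obtain ⟨x, hx⟩ := P.nonempty_of_mem_parts hC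
    exact P.eq_of_mem_parts hC hB hx (hle hx)

theorem sum_finpartition_part_eq {R : Type*} [CommSemiring R] (k : Finset ι → R) (hB : B ⊆ s)
    (ha : a ∈ B) :
    ∑ P : Finpartition s with P.part a = B, ∏ C ∈ P.parts, k C
      = k B * ∑ Q : Finpartition (s \ B), ∏ C ∈ Q.parts, k C := by
  have hnotMem (Q : Finpartition (s \ B)) : B ∉ Q.parts := fun h =>
    (Finset.mem_sdiff.1 (Q.le h ha)).2 ha
  let extend (Q : Finpartition (s \ B)) : Finpartition s :=
    Q.extend (Finset.ne_empty_of_mem ha) Finset.sdiff_disjoint (Finset.sdiff_union_of_subset hB)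
  have hmem (P : Finpartition s) (hP : P ∈ Finset.univ.filter fun P => P.part a = B) :
      B ∈ P.parts := by
    obtain rfl := (Finset.mem_filter_univ _).1 hP
    exact P.part_mem.2 (hB ha)
  rw [Finset.mul_sum]
  refine Finset.sum_bij' (fun P _ => P.avoid B) (fun Q _ => extend Q) (fun _ _ => Finset.mem_univ _)
    (fun Q _ => ?_) (fun P hP => Finpartition.ext ?_) (fun Q _ => Finpartition.ext ?_)
    fun P hP => ?_
  · exact (Finset.mem_filter_univ _).2
      ((extend Q).part_eq_of_mem (Finset.mem_insert_self _ _) ha)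
  · change insert B (P.avoid B).parts = P.parts
    rw [parts_avoid_of_mem P (hmem P hP), Finset.insert_erase (hmem P hP)]
  · rw [parts_avoid_of_mem _ (Finset.mem_insert_self _ _)]
    exact Finset.erase_insert (hnotMem Q)
  · rw [parts_avoid_of_mem P (hmem P hP), Finset.mul_prod_erase _ _ (hmem P hP)]

theorem sum_finpartition_eq_sum_mul {R : Type*} [CommSemiring R] (k : Finset ι → R) (ha : a ∈ s) :
    ∑ P : Finpartition s, ∏ C ∈ P.parts, k C
      = ∑ B ∈ s.powerset with a ∈ B, k B * ∑ Q : Finpartition (s \ B), ∏ C ∈ Q.parts, k C := by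
  rw [← Finset.sum_fiberwise_of_maps_to (g := fun P => P.part a)
    (t := s.powerset.filter (a ∈ ·)) fun P _ => by simp [P.part_subset, P.mem_part_self.2 ha]]
  refine Finset.sum_congr rfl fun B hB => ?_
  rw [Finset.mem_filter, Finset.mem_powerset] at hB
  exact sum_finpartition_part_eq k hB.1 hB.2

variable {A : Type*} [CommRing A] [Module ℂ A] {E : A →ₗ[ℂ] ℂ} {X : ι → A}

theorem sum_prod_jointCumulant (hE : E 1 = 1) (s : Finset ι) :
    ∑ P : Finpartition s, ∏ C ∈ P.parts, jointCumulant E X C = E (∏ i ∈ s, X i) := by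
  rcases s.eq_empty_or_nonempty with rfl | hs
  · have : Unique (Finpartition (∅ : Finset ι)) :=
      inferInstanceAs (Unique (Finpartition (⊥ : Finset ι)))
    rw [Fintype.sum_unique, Finpartition.parts_eq_empty_iff.2 rfl, Finset.prod_empty,
      Finset.prod_empty, hE]
  · exact (moment_eq_sum_jointCumulant E X s hs).symm

theorem map_prod_eq_sum_jointCumulant_mul (hE : E 1 = 1) (ha : a ∈ s) :
    E (∏ i ∈ s, X i)
      = ∑ B ∈ s.powerset with a ∈ B, jointCumulant E X B * E (∏ i ∈ s \ B, X i) := by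
  simp only [← sum_prod_jointCumulant hE, sum_finpartition_eq_sum_mul (jointCumulant E X) ha]

theorem jointCumulant_eq_of_recursion (hE : E 1 = 1) {K : Finset ι → ℂ}
    (hK : ∀ (s : Finset ι) (a : ι), a ∈ s →
      E (∏ i ∈ s, X i) = ∑ B ∈ s.powerset with a ∈ B, K B * E (∏ i ∈ s \ B, X i))
    (hs : s.Nonempty) : jointCumulant E X s = K s := by
  induction s using Finset.strongInduction with
  | H s ih =>
    obtain ⟨a, ha⟩ := hs
    have hrec := (map_prod_eq_sum_jointCumulant_mul hE ha).symm.trans (hK s a ha)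
    have hmem : s ∈ s.powerset.filter (a ∈ ·) := by simp [ha]
    rw [← Finset.add_sum_erase _ _ hmem, ← Finset.add_sum_erase _ _ hmem,
      Finset.sum_congr rfl fun B hB => ?_] at hrec
    · simpa [hE] using add_right_cancel hrec
    · rw [Finset.mem_erase, Finset.mem_filter, Finset.mem_powerset] at hB
      obtain ⟨hne, hsub, haB⟩ := hB
      rw [ih B (hsub.ssubset_of_ne hne) ⟨a, haB⟩]

end Cumulants

/-! ### Connected factorizations -/

section Components

variable {X ι : Type*} {c : X → ι} {σ : Equiv.Perm X × Equiv.Perm X} {B C : Finset ι}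

/-- The points whose label is in `B` are permuted among themselves by `σ₁` and by `σ₂`. -/
def IsLabelInvariant (c : X → ι) (σ : Equiv.Perm X × Equiv.Perm X) (B : Finset ι) : Prop :=
  (∀ x, c (σ.1 x) ∈ B ↔ c x ∈ B) ∧ ∀ x, c (σ.2 x) ∈ B ↔ c x ∈ B

/-- The connected components of the set of labels, where `σ₁` and `σ₂` connect the label of each
point to the label of its image. -/
def IsLabelComponent (c : X → ι) (σ : Equiv.Perm X × Equiv.Perm X) (B : Finset ι) : Prop :=
  Minimal (fun C => C.Nonempty ∧ IsLabelInvariant c σ C) B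

theorem isLabelComponent_congr {Y : Type*} {d : Y → ι} {τ : Equiv.Perm Y × Equiv.Perm Y}
    (h : ∀ C ⊆ B, IsLabelInvariant c σ C ↔ IsLabelInvariant d τ C) :
    IsLabelComponent c σ B ↔ IsLabelComponent d τ B := by
  refine and_congr (and_congr_right' (h B subset_rfl)) (forall_congr' fun C => ?_)
  exact ⟨fun hC hD hle => hC ⟨hD.1, (h C hle).2 hD.2⟩ hle,
    fun hC hD hle => hC ⟨hD.1, (h C hle).1 hD.2⟩ hle⟩

theorem IsLabelInvariant.inter [DecidableEq ι] (hB : IsLabelInvariant c σ B)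
    (hC : IsLabelInvariant c σ C) :
    IsLabelInvariant c σ (B ∩ C) := by
  simp only [IsLabelInvariant, Finset.mem_inter, hB.1, hB.2, hC.1, hC.2, implies_true, and_self]

theorem IsLabelInvariant.sdiff [DecidableEq ι] (hB : IsLabelInvariant c σ B)
    (hC : IsLabelInvariant c σ C) :
    IsLabelInvariant c σ (B \ C) := by
  simp only [IsLabelInvariant, Finset.mem_sdiff, hB.1, hB.2, hC.1, hC.2, implies_true, and_self]

theorem IsLabelComponent.eq_of_mem (hB : IsLabelComponent c σ B) (hC : IsLabelComponent c σ C)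
    {a : ι} (haB : a ∈ B) (haC : a ∈ C) : B = C := by
  classical
  have hinter : (B ∩ C).Nonempty ∧ IsLabelInvariant c σ (B ∩ C) :=
    ⟨⟨a, Finset.mem_inter.2 ⟨haB, haC⟩⟩, hB.1.2.inter hC.1.2⟩
  exact (Minimal.eq_of_ge hB hinter Finset.inter_subset_left).trans
    (Minimal.eq_of_le hC hinter Finset.inter_subset_right)

theorem IsLabelInvariant.exists_isLabelComponent (hB : IsLabelInvariant c σ B) {a : ι}
    (ha : a ∈ B) :
    ∃ C ⊆ B, a ∈ C ∧ IsLabelComponent c σ C := by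
  classical
  obtain ⟨C, hCB, hC⟩ := exists_minimal_le_of_wellFoundedLT
    (fun C => a ∈ C ∧ IsLabelInvariant c σ C) B ⟨ha, hB⟩
  refine ⟨C, hCB, hC.1.1, ⟨⟨a, hC.1.1⟩, hC.1.2⟩, fun D hD hDC => ?_⟩
  by_cases haD : a ∈ D
  · exact hC.2 ⟨haD, hD.2⟩ hDC
  · have hsdiff : C ⊆ C \ D :=
      hC.2 ⟨Finset.mem_sdiff.2 ⟨hC.1.1, haD⟩, hC.1.2.sdiff hD.2⟩ Finset.sdiff_subset
    obtain ⟨d, hd⟩ := hD.1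
    exact absurd hd (Finset.mem_sdiff.1 (hsdiff (hDC hd))).2

end Components

section ComponentSum

variable {X Y ι : Type*} {lam : YoungDiagram} {σ : Equiv.Perm X × Equiv.Perm X}

theorem adapted_sumCongr_iff {τ : Equiv.Perm Y × Equiv.Perm Y} {f : X ⊕ Y → lam.cells} :
    Adapted (Equiv.Perm.sumCongr σ.1 τ.1, Equiv.Perm.sumCongr σ.2 τ.2) f ↔
      Adapted σ (f ∘ Sum.inl) ∧ Adapted τ (f ∘ Sum.inr) := by
  simp only [Adapted, Sum.forall, Equiv.Perm.sumCongr_apply, Sum.map_inl, Sum.map_inr,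
    Function.comp_apply]
  tauto

theorem adapted_permCongr_iff (e : X ≃ Y) {f : Y → lam.cells} :
    Adapted (e.permCongr σ.1, e.permCongr σ.2) f ↔ Adapted σ (f ∘ e) := by
  simp only [Adapted, Equiv.permCongr_apply, Function.comp_apply, ← e.forall_congr_right,
    Equiv.symm_apply_apply]

theorem isLabelInvariant_permCongr_iff (e : X ≃ Y) {c : Y → ι} {B : Finset ι} :
    IsLabelInvariant c (e.permCongr σ.1, e.permCongr σ.2) B ↔ IsLabelInvariant (c ∘ e) σ B := by
  simp only [IsLabelInvariant, Equiv.permCongr_apply, Function.comp_apply, ← e.forall_congr_right,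
    Equiv.symm_apply_apply]

theorem isLabelInvariant_sumCongr_iff {τ : Equiv.Perm Y × Equiv.Perm Y} {c : X ⊕ Y → ι}
    {B : Finset ι} (hB : ∀ y, c (.inr y) ∉ B) :
    IsLabelInvariant c (Equiv.Perm.sumCongr σ.1 τ.1, Equiv.Perm.sumCongr σ.2 τ.2) B ↔
      IsLabelInvariant (c ∘ Sum.inl) σ B := by
  simp only [IsLabelInvariant, Sum.forall, Equiv.Perm.sumCongr_apply, Sum.map_inl, Sum.map_inr,
    Function.comp_apply, hB, implies_true, and_true]

theorem exists_sumCongr_eq_of_isLabelInvariant [Finite X] [Finite Y] {c : X ⊕ Y → ι} {B : Finset ι}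
    (hX : ∀ x, c (.inl x) ∈ B) (hY : ∀ y, c (.inr y) ∉ B)
    {ρ : Equiv.Perm (X ⊕ Y)} (hρ : ∀ x, c (ρ x) ∈ B ↔ c x ∈ B) :
    ∃ σ τ, Equiv.Perm.sumCongr σ τ = ρ := by
  have hrange : Set.MapsTo ρ (Set.range Sum.inl) (Set.range Sum.inl) := by
    rintro _ ⟨x, rfl⟩
    rcases hx : ρ (.inl x) with z | z
    · exact ⟨z, rfl⟩
    · exact absurd ((hρ (.inl x)).2 (hX x)) (hx ▸ hY z)
  obtain ⟨⟨σ, τ⟩, h⟩ := Equiv.Perm.mem_sumCongrHom_range_of_perm_mapsTo_inl hrange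
  exact ⟨σ, τ, h⟩

variable [DecidableEq X] [DecidableEq Y]

theorem signedColorings_sumCongr [Finite X] [Finite Y] (σ : Equiv.Perm X × Equiv.Perm X)
    (τ : Equiv.Perm Y × Equiv.Perm Y) :
    signedColorings lam (Equiv.Perm.sumCongr σ.1 τ.1, Equiv.Perm.sumCongr σ.2 τ.2)
      = signedColorings lam σ * signedColorings lam τ := by
  have := Fintype.ofFinite X
  have := Fintype.ofFinite Y
  have hcard := Nat.card_congr (((Equiv.sumArrowEquivProdArrow X Y lam.cells).subtypeEquiv
    fun _ => adapted_sumCongr_iff (σ := σ) (τ := τ)).trans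
      (Equiv.subtypeProdEquivProd (p := Adapted σ) (q := Adapted τ)))
  simp only [signedColorings_eq_sign_mul_card, hcard, Nat.card_prod, Equiv.Perm.sign_sumCongr]
  push_cast
  ring

theorem signedColorings_permCongr [Finite X] [Finite Y] (e : X ≃ Y)
    (σ : Equiv.Perm X × Equiv.Perm X) :
    signedColorings lam (e.permCongr σ.1, e.permCongr σ.2) = signedColorings lam σ := by
  have := Fintype.ofFinite X
  have := Fintype.ofFinite Y
  have hcard := Nat.card_congr ((e.symm.arrowCongr (Equiv.refl lam.cells)).subtypeEquiv
    fun _ => adapted_permCongr_iff (σ := σ) e)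
  simp only [signedColorings_eq_sign_mul_card, Equiv.Perm.sign_permCongr]
  rw [hcard]

variable [Fintype X] [Fintype Y]

open scoped Classical in
/-- The signed number of colored factorizations `σ₁ σ₂ = π` for which `B` is a connected component
of the set of labels. For `B` the set of all labels it is the cumulant. -/
noncomputable def componentSum (lam : YoungDiagram) (c : X → ι) (π : Equiv.Perm X)
    (B : Finset ι) : ℂ :=
  ∑ σ : Equiv.Perm X × Equiv.Perm X with σ.1 * σ.2 = π ∧ IsLabelComponent c σ B,
    signedColorings lam σ

theorem signedFactorizations_eq_sum_componentSum [DecidableEq ι] {c : X → ι} {s : Finset ι}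
    {a : ι} (hc : ∀ x, c x ∈ s) (ha : a ∈ s) (π : Equiv.Perm X) :
    signedFactorizations lam π = ∑ B ∈ s.powerset with a ∈ B, componentSum lam c π B := by
  classical
  simp only [signedFactorizations, componentSum, ← Finset.filter_filter]
  simp only [Finset.sum_filter (IsLabelComponent c · _)]
  rw [Finset.sum_comm]
  refine Finset.sum_congr rfl fun σ _ => ?_
  have hs : IsLabelInvariant c σ s := by simp only [IsLabelInvariant, hc, implies_true, and_self]
  obtain ⟨B, hBs, haB, hB⟩ := hs.exists_isLabelComponent ha
  rw [Finset.sum_eq_single_of_mem B (by simp [hBs, haB]), if_pos hB]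
  exact fun C hC hne => if_neg fun hcomp =>
    hne (hcomp.eq_of_mem hB (Finset.mem_filter.1 hC).2 haB)

theorem componentSum_permCongr (e : X ≃ Y) (c : Y → ι) (π : Equiv.Perm X) (B : Finset ι) :
    componentSum lam c (e.permCongr π) B = componentSum lam (c ∘ e) π B := by
  classical
  refine (Finset.sum_equiv (e.permCongr.prodCongr e.permCongr) (fun σ => ?_)
    fun σ _ => (signedColorings_permCongr e σ).symm).symm
  have hcomp : IsLabelComponent c (e.permCongr σ.1, e.permCongr σ.2) B ↔
      IsLabelComponent (c ∘ e) σ B :=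
    isLabelComponent_congr fun C _ => isLabelInvariant_permCongr_iff e
  have hmul : e.permCongr σ.1 * e.permCongr σ.2 = e.permCongr π ↔ σ.1 * σ.2 = π := by
    rw [← e.permCongr_mul, e.permCongr.apply_eq_iff_eq]
  rw [Finset.mem_filter_univ, Finset.mem_filter_univ, ← hcomp, ← hmul]
  rfl

theorem componentSum_sumCongr {c : X ⊕ Y → ι} {B : Finset ι} (hX : ∀ x, c (.inl x) ∈ B)
    (hY : ∀ y, c (.inr y) ∉ B) (π : Equiv.Perm X) (ρ : Equiv.Perm Y) :
    componentSum lam c (Equiv.Perm.sumCongr π ρ) B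
      = componentSum lam (c ∘ Sum.inl) π B * signedFactorizations lam ρ := by
  classical
  have hinj {σ₁ σ₂ : Equiv.Perm X} {τ₁ τ₂ : Equiv.Perm Y} :
      Equiv.Perm.sumCongr σ₁ τ₁ = Equiv.Perm.sumCongr σ₂ τ₂ ↔ σ₁ = σ₂ ∧ τ₁ = τ₂ :=
    ((Equiv.Perm.sumCongrHom_injective (α := X) (β := Y)).eq_iff (a := (σ₁, τ₁))
      (b := (σ₂, τ₂))).trans Prod.mk_inj
  have hcomp (σ : Equiv.Perm X × Equiv.Perm X) (τ : Equiv.Perm Y × Equiv.Perm Y) :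
      IsLabelComponent c (Equiv.Perm.sumCongr σ.1 τ.1, Equiv.Perm.sumCongr σ.2 τ.2) B ↔
        IsLabelComponent (c ∘ Sum.inl) σ B :=
    isLabelComponent_congr fun C hC => isLabelInvariant_sumCongr_iff fun y hy => hY y (hC hy)
  rw [componentSum, componentSum, signedFactorizations, Finset.sum_mul_sum,
    ← Finset.sum_product']
  refine (Finset.sum_bij (fun p _ => (Equiv.Perm.sumCongr p.1.1 p.2.1,
    Equiv.Perm.sumCongr p.1.2 p.2.2)) ?_ ?_ ?_ ?_).symm
  · rintro ⟨σ, τ⟩ h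
    simp only [Finset.mem_product, Finset.mem_filter_univ] at h
    exact (Finset.mem_filter_univ _).2
      ⟨by rw [Equiv.Perm.sumCongr_mul, h.1.1, h.2], (hcomp σ τ).2 h.1.2⟩
  · rintro ⟨σ, τ⟩ _ ⟨σ', τ'⟩ _ h
    obtain ⟨h₁, h₂⟩ := Prod.mk_inj.1 h
    rw [hinj] at h₁ h₂
    exact Prod.ext (Prod.ext h₁.1 h₂.1) (Prod.ext h₁.2 h₂.2)
  · rintro ⟨ρ₁, ρ₂⟩ h
    obtain ⟨hmul, hB⟩ := (Finset.mem_filter_univ _).1 h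
    obtain ⟨σ₁, τ₁, rfl⟩ := exists_sumCongr_eq_of_isLabelInvariant hX hY hB.1.2.1
    obtain ⟨σ₂, τ₂, rfl⟩ := exists_sumCongr_eq_of_isLabelInvariant hX hY hB.1.2.2
    rw [Equiv.Perm.sumCongr_mul, hinj] at hmul
    refine ⟨((σ₁, σ₂), (τ₁, τ₂)), ?_, rfl⟩
    simp only [Finset.mem_product, Finset.mem_filter_univ]
    exact ⟨⟨hmul.1, (hcomp (σ₁, σ₂) (τ₁, τ₂)).1 hB⟩, hmul.2⟩
  · rintro ⟨σ, τ⟩ _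
    exact (signedColorings_sumCongr σ τ).symm

end ComponentSum

section DisjointCumulant

variable {n : ℕ} {lam : YoungDiagram} (T : Fin n ≃ lam.cells)
  {X ι : Type*} [Fintype X] [DecidableEq X] [DecidableEq ι] {c : X → ι} {π : Equiv.Perm X}

theorem componentSum_blockPerm_union (hπ : ∀ x, c (π x) = c x) {B C : Finset ι}
    (hBC : Disjoint B C) :
    componentSum lam (fun x : Block c (B ∪ C) => c x) (blockPerm hπ (B ∪ C)) B
      = componentSum lam (fun x : Block c B => c x) (blockPerm hπ B) B
          * signedFactorizations lam (blockPerm hπ C) := by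
  have hperm : (blockSumEquiv hBC).permCongr (Equiv.Perm.sumCongr (blockPerm hπ B) (blockPerm hπ C))
      = blockPerm hπ (B ∪ C) := by
    ext1 x
    rw [Equiv.permCongr_apply, (semiconj_blockSumEquiv hπ hBC).eq, Equiv.apply_symm_apply]
  rw [← hperm, componentSum_permCongr]
  exact componentSum_sumCongr (fun x => x.2) (fun y => Finset.disjoint_right.1 hBC y.2) _ _

theorem jointCumulant_classSum_blockPerm (hπ : ∀ x, c (π x) = c x) {s : Finset ι}
    (hs : s.Nonempty) :
    jointCumulant (charExpectation (youngRep T)) (fun i => classSum n (blockPerm hπ {i})) s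
      = componentSum lam (fun x : Block c s => c x) (blockPerm hπ s) s := by
  refine jointCumulant_eq_of_recursion (charExpectation_one T)
    (K := fun s => componentSum lam (fun x : Block c s => c x) (blockPerm hπ s) s)
    (fun s a ha => ?_) hs
  simp only [prod_classSum_blockPerm, charExpectation_classSum]
  rw [signedFactorizations_eq_sum_componentSum (fun x : Block c s => x.2) ha]
  refine Finset.sum_congr rfl fun B hB => ?_
  have hBs : B ⊆ s := Finset.mem_powerset.1 (Finset.mem_filter.1 hB).1
  rw [← componentSum_blockPerm_union hπ Finset.disjoint_sdiff, Finset.union_sdiff_of_subset hBs]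

theorem componentSum_blockPerm_univ [Fintype ι] (hπ : ∀ x, c (π x) = c x) (B : Finset ι) :
    componentSum lam (fun x : Block c Finset.univ => c x) (blockPerm hπ Finset.univ) B
      = componentSum lam c π B :=
  (componentSum_permCongr (Equiv.subtypeUnivEquiv fun x => Finset.mem_univ (c x)) c _ B).symm

theorem disjointCumulant_youngRep {r : ℕ} (hr : 1 ≤ r) (l : Fin r → ℕ)
    (π : (i : Fin r) → Equiv.Perm (Fin (l i))) :
    disjointCumulant (youngRep T) l π
      = componentSum lam Sigma.fst (Equiv.Perm.sigmaCongrRight π) Finset.univ := by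
  have : Nonempty (Fin r) := ⟨⟨0, hr⟩⟩
  simp only [disjointCumulant, conjClassSum_eq_classSum_blockPerm n l π]
  rw [jointCumulant_classSum_blockPerm T (fst_sigmaCongrRight π) Finset.univ_nonempty,
    componentSum_blockPerm_univ]

end DisjointCumulant

section Transitivity

variable {r : ℕ} {l : Fin r → ℕ} {σ : Equiv.Perm (Σ i, Fin (l i)) × Equiv.Perm (Σ i, Fin (l i))}

/-- The group generated by `σ₁`, `σ₂` and `S_{l_1} × ⋯ × S_{l_r}`. -/
def generatedGroup (σ : Equiv.Perm (Σ i, Fin (l i)) × Equiv.Perm (Σ i, Fin (l i))) :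
    Subgroup (Equiv.Perm (Σ i, Fin (l i))) :=
  Subgroup.closure ({σ.1, σ.2} ∪ Set.range (Equiv.Perm.sigmaCongrRightHom fun i => Fin (l i)))

theorem fst_apply_mem_iff_of_mem_generatedGroup {C : Finset (Fin r)}
    (hC : IsLabelInvariant Sigma.fst σ C) {g : Equiv.Perm (Σ i, Fin (l i))}
    (hg : g ∈ generatedGroup σ) (x : Σ i, Fin (l i)) : (g x).1 ∈ C ↔ x.1 ∈ C := by
  induction hg using Subgroup.closure_induction generalizing x with
  | mem g hg =>
    obtain (rfl | rfl) | ⟨τ, rfl⟩ := hg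
    · exact hC.1 x
    · exact hC.2 x
    · rfl
  | one => rfl
  | mul g h _ _ ihg ihh => rw [Equiv.Perm.mul_apply, ihg, ihh]
  | inv g _ ih => rw [← ih, ← Equiv.Perm.mul_apply, mul_inv_cancel, Equiv.Perm.one_apply]

theorem exists_mem_generatedGroup_of_fst_eq {x y : Σ i, Fin (l i)} (hxy : x.1 = y.1) :
    ∃ g ∈ generatedGroup σ, g x = y := by
  obtain ⟨i, a⟩ := x
  obtain ⟨j, b⟩ := y
  obtain rfl : i = j := hxy
  refine ⟨Equiv.Perm.sigmaCongrRightHom _ (Function.update 1 i (Equiv.swap a b)),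
    Subgroup.subset_closure (.inr ⟨_, rfl⟩), ?_⟩
  simp

theorem ActTransitively.isLabelComponent_univ (hσ : ActTransitively l σ.1 σ.2) (hr : 1 ≤ r)
    (hl : ∀ i, 1 ≤ l i) : IsLabelComponent Sigma.fst σ Finset.univ := by
  refine ⟨⟨⟨⟨0, hr⟩, Finset.mem_univ _⟩, by simp [IsLabelInvariant]⟩, ?_⟩
  rintro C ⟨⟨i, hi⟩, hC⟩ - j -
  obtain ⟨⟨g, hg⟩, hgi⟩ := hσ.exists_smul_eq ⟨i, ⟨0, hl i⟩⟩ ⟨j, ⟨0, hl j⟩⟩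
  have hmem := fst_apply_mem_iff_of_mem_generatedGroup hC hg ⟨i, ⟨0, hl i⟩⟩
  change g _ = _ at hgi
  rw [hgi] at hmem
  exact hmem.2 hi

theorem IsLabelComponent.actTransitively (hσ : IsLabelComponent Sigma.fst σ Finset.univ) :
    ActTransitively l σ.1 σ.2 := by
  classical
  refine ⟨fun x y => ?_⟩
  change y ∈ MulAction.orbit (generatedGroup σ) x
  have hsmul (g : generatedGroup σ) (z : Σ i, Fin (l i)) :
      g • z ∈ MulAction.orbit (generatedGroup σ) x ↔ z ∈ MulAction.orbit (generatedGroup σ) x := by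
    rw [← MulAction.orbit_eq_iff, MulAction.orbit_smul, MulAction.orbit_eq_iff]
  let C : Finset (Fin r) := {i | ∃ z ∈ MulAction.orbit (generatedGroup σ) x, z.1 = i}
  have hC (z : Σ i, Fin (l i)) : z.1 ∈ C ↔ z ∈ MulAction.orbit (generatedGroup σ) x := by
    rw [Finset.mem_filter_univ]
    refine ⟨fun ⟨w, hw, hwz⟩ => ?_, fun hz => ⟨z, hz, rfl⟩⟩
    obtain ⟨g, hg, rfl⟩ := exists_mem_generatedGroup_of_fst_eq (σ := σ) hwz
    exact (hsmul ⟨g, hg⟩ w).2 hw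
  have hinvariant : IsLabelInvariant Sigma.fst σ C := by
    simp only [IsLabelInvariant, hC]
    exact ⟨hsmul ⟨σ.1, Subgroup.subset_closure (by simp)⟩,
      hsmul ⟨σ.2, Subgroup.subset_closure (by simp)⟩⟩
  have hx : x.1 ∈ C := (hC x).2 (MulAction.mem_orbit_self x)
  exact (hC y).1 (hσ.2 ⟨⟨x.1, hx⟩, hinvariant⟩ (Finset.subset_univ C) (Finset.mem_univ y.1))

end Transitivity

open Classical in
theorem mainTheorem12 {n : ℕ} (lam : YoungDiagram) (T : Fin n ≃ lam.cells)
    {r : ℕ} (hr : 1 ≤ r) (l : Fin r → ℕ) (hl : ∀ i, 1 ≤ l i)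
    (π : (i : Fin r) → Equiv.Perm (Fin (l i))) :
    disjointCumulant (youngRep T) l π =
      ∑ σ : Equiv.Perm (Σ i, Fin (l i)) × Equiv.Perm (Σ i, Fin (l i)) with
          σ.1 * σ.2 = Equiv.Perm.sigmaCongrRight π ∧ ActTransitively l σ.1 σ.2,
        (-1 : ℂ) ^ reflectionLength σ.1 * (colorings lam σ.1 σ.2 : ℂ) := by
  have htransitive (σ : Equiv.Perm (Σ i, Fin (l i)) × Equiv.Perm (Σ i, Fin (l i))) :
      ActTransitively l σ.1 σ.2 ↔ IsLabelComponent Sigma.fst σ Finset.univ :=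
    ⟨fun hσ => hσ.isLabelComponent_univ hr hl, IsLabelComponent.actTransitively⟩
  simp only [disjointCumulant_youngRep T hr, componentSum, signedColorings, htransitive]
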